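/- Let $n\ge 0$ and $\mathbf n=\{1,\dots,n\}$. Let $B_n$ be the planar upper triangular rook monoid, i.e. the monoid, under composition of partial maps ($gf$ means first $f$, then $g$), of all injective partial maps $f$ from $\mathbf n$ to $\mathbf n$ that are order preserving ($f(a)<f(b)$ whenever $a<b$ lie in the domain of $f$) and order decreasing ($f(a)\le a$ for every $a$ in the domain of $f$). For $1\le i\le n-1$ let $l_i\in B_n$ be the map with domain $\mathbf n\setminus\{i\}$ that sends $i+1$ to $i$ and fixes every other point of its domain, and for $1\le j\le n$ let $e_j\in B_n$ be the identity map of $\mathbf n\setminus\{j\}$. Let $G=\{1\}\cup\{l_i : 1\le i\le n-1\}\cup\{e_j : 1\le j\le n\}$, and let $R$ be the following set of relations, where the indices $i,j$ range over all values for which the expressions are meaningful: 1. $e_i^2=e_i$; 2. $l_il_{i+1}l_i=l_il_{i+1}=l_{i+1}l_il_{i+1}$; 3. $l_ie_i=l_i=e_{i+1}l_i$; 4. $l_ie_{i+1}=e_ie_{i+1}=e_il_i=l_i^3=l_i^2$; 5. $e_il_j=l_je_i$ for $i\ne j,\,j+1$; 6. $l_il_j=l_jl_i$ for $|i-j|\ge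 2$; 7. $e_ie_j=e_je_i$ for all $i,j$. **Theorem.** The monoid $B_n$ has the monoid presentation $\langle G\mid R\rangle$. That is, the monoid generated by the symbols in $G$ subject to the relations $R$, where the symbol $1$ denotes the identity element, is isomorphic to $B_n$ by an isomorphism that sends each symbol of $G$ to the element of $B_n$ it names. -/

import Mathlib

/-!
The set `{1, …, n}` is modelled by `Fin n`, with the number `a + 1` represented by the element of
value `a`; all indices below are accordingly shifted down by one.
-/

/-- The rook monoid `R_n`: injective partial maps from `{1, …, n}` to itself. -/
def RookMonoid (n : ℕ) : Type := Fin n ≃. Fin n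

namespace RookMonoid

/-- The product `g * f` is the composition `g ∘ f` of partial maps (first `f`, then `g`), and `1` is
the identity map. -/
instance instMonoid (n : ℕ) : Monoid (RookMonoid n) where
  mul g f := PEquiv.trans f g
  one := PEquiv.refl (Fin n)
  mul_assoc h g f := (PEquiv.trans_assoc f g h).symm
  one_mul f := PEquiv.trans_refl f
  mul_one f := PEquiv.refl_trans f

/-- `f.MapsTo a x` means that `a` lies in the domain of `f` and `f(a) = x`. -/
def MapsTo {n : ℕ} (f : RookMonoid n) (a x : Fin n) : Prop :=
  (show Fin n ≃. Fin n from f) a = some x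

theorem mapsTo_one {n : ℕ} {a x : Fin n} : (1 : RookMonoid n).MapsTo a x ↔ a = x :=
  Option.some_inj

theorem mapsTo_mul {n : ℕ} {g f : RookMonoid n} {a x : Fin n} :
    (g * f).MapsTo a x ↔ ∃ b, f.MapsTo a b ∧ g.MapsTo b x :=
  PEquiv.trans_eq_some f g a x

/-- `a < b` in the domain of `f` implies `f(a) < f(b)`. -/
def OrderPreserving {n : ℕ} (f : RookMonoid n) : Prop :=
  ∀ a b x y : Fin n, f.MapsTo a x → f.MapsTo b y → a < b → x < y

/-- `f(a) ≤ a` for all `a` in the domain of `f`. -/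
def OrderDecreasing {n : ℕ} (f : RookMonoid n) : Prop :=
  ∀ a x : Fin n, f.MapsTo a x → x ≤ a

end RookMonoid

/-- The planar upper triangular rook monoid `B_n`: the order preserving, order decreasing injective
partial maps from `{1, …, n}` to itself. -/
def planarUpperRook (n : ℕ) : Submonoid (RookMonoid n) where
  carrier := {f | f.OrderPreserving ∧ f.OrderDecreasing}
  one_mem' := by
    refine ⟨fun a b x y hx hy hab => ?_, fun a x hx => ?_⟩
    · rw [RookMonoid.mapsTo_one] at hx hy
      subst hx hy
      exact hab
    · rw [RookMonoid.mapsTo_one] at hx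
      exact hx.ge
  mul_mem' := by
    rintro g f ⟨hg, hg'⟩ ⟨hf, hf'⟩
    refine ⟨fun a b x y hx hy hab => ?_, fun a x hx => ?_⟩
    · obtain ⟨c, hc, hc'⟩ := RookMonoid.mapsTo_mul.1 hx
      obtain ⟨d, hd, hd'⟩ := RookMonoid.mapsTo_mul.1 hy
      exact hg c d x y hc' hd' (hf a b c d hc hd hab)
    · obtain ⟨c, hc, hc'⟩ := RookMonoid.mapsTo_mul.1 hx
      exact (hg' c x hc').trans (hf' a c hc)

/-- The partial map `l_i` for `1 ≤ i ≤ n - 1`: it is undefined at `i`, sends `i + 1` to `i` and fixes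
every other point. -/
def lMap {n : ℕ} (i : ℕ) (h : i + 1 < n) : RookMonoid n :=
  show Fin n ≃. Fin n from
  { toFun := fun a =>
      if a.val = i then none else if a.val = i + 1 then some ⟨i, by omega⟩ else some a
    invFun := fun b =>
      if b.val = i + 1 then none else if b.val = i then some ⟨i + 1, h⟩ else some b
    inv := by
      intro a b
      rcases a with ⟨a, ha⟩
      rcases b with ⟨b, hb⟩
      dsimp only
      split_ifs <;> simp <;> omega }

/-- The partial identity `e_j` for `1 ≤ j ≤ n`: it is undefined at `j` and fixes every other point. -/
def eMap {n : ℕ} (j : ℕ) (_ : j < n) : RookMonoid n :=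
  PEquiv.ofSet {a : Fin n | a.val ≠ j}

theorem lMap_mem {n : ℕ} (i : ℕ) (h : i + 1 < n) : lMap i h ∈ planarUpperRook n := by
  have key : ∀ a x : Fin n, (lMap i h).MapsTo a x →
      (a.val ≠ i ∧ ((a.val = i + 1 ∧ x.val = i) ∨ (a.val ≠ i + 1 ∧ x.val = a.val))) := by
    intro a x hx
    change (if a.val = i then none else if a.val = i + 1 then some ⟨i, _⟩ else some a)
      = some x at hx
    split_ifs at hx with h1 h2
    · exact ⟨h1, Or.inl ⟨h2, by rw [← Option.some_inj.1 hx]⟩⟩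
    · exact ⟨h1, Or.inr ⟨h2, by rw [← Option.some_inj.1 hx]⟩⟩
  refine ⟨fun a b x y hx hy hab => ?_, fun a x hx => ?_⟩
  · have h1 := key a x hx
    have h2 := key b y hy
    rw [Fin.lt_def] at hab ⊢
    omega
  · have h1 := key a x hx
    rw [Fin.le_def]
    omega

theorem eMap_mem {n : ℕ} (j : ℕ) (h : j < n) : eMap j h ∈ planarUpperRook n := by
  have key : ∀ a x : Fin n, (eMap j h).MapsTo a x → a = x := by
    intro a x hx
    exact ((PEquiv.mem_ofSet_iff (s := {a : Fin n | a.val ≠ j})).1 hx).1.symm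
  refine ⟨fun a b x y hx hy hab => ?_, fun a x hx => (key a x hx).ge⟩
  rw [← key a x hx, ← key b y hy]
  exact hab

/-- The symbols of the generating set `G`: `1`, the `l_i` with `1 ≤ i ≤ n - 1`, and the `e_j` with
`1 ≤ j ≤ n`. -/
inductive RookGen (n : ℕ) : Type
  | one : RookGen n
  | l (i : ℕ) (h : i + 1 < n) : RookGen n
  | e (j : ℕ) (h : j < n) : RookGen n

/-- The element of `B_n` that a generating symbol stands for. -/
def RookGen.toRook {n : ℕ} : RookGen n → planarUpperRook n
  | .one => 1
  | .l i h => ⟨lMap i h, lMap_mem i h⟩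
  | .e j h => ⟨eMap j h, eMap_mem j h⟩

/-- The symbol `l_i` as a word of length one. -/
def lWord {n : ℕ} (i : ℕ) (h : i + 1 < n) : FreeMonoid (RookGen n) := FreeMonoid.of (.l i h)

/-- The symbol `e_j` as a word of length one. -/
def eWord {n : ℕ} (j : ℕ) (h : j < n) : FreeMonoid (RookGen n) := FreeMonoid.of (.e j h)

/-- The defining relations. The first constructor is the convention that the symbol `1` denotes the
identity (the empty word); the others are the seven families of relations, for all indices for which
the symbols exist, a chain of equalities being split into its consecutive links. -/
inductive RookRel (n : ℕ) : FreeMonoid (RookGen n) → FreeMonoid (RookGen n) → Prop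
  | one_eq : RookRel n (FreeMonoid.of .one) 1
  | e_idem (i : ℕ) (h : i < n) : RookRel n (eWord i h ^ 2) (eWord i h)
  | braid_left (i : ℕ) (h : i + 1 < n) (h' : i + 1 + 1 < n) :
      RookRel n (lWord i h * lWord (i + 1) h' * lWord i h) (lWord i h * lWord (i + 1) h')
  | braid_right (i : ℕ) (h : i + 1 < n) (h' : i + 1 + 1 < n) :
      RookRel n (lWord i h * lWord (i + 1) h')
        (lWord (i + 1) h' * lWord i h * lWord (i + 1) h')
  | l_e_self (i : ℕ) (h : i + 1 < n) (h₀ : i < n) :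
      RookRel n (lWord i h * eWord i h₀) (lWord i h)
  | e_succ_l (i : ℕ) (h : i + 1 < n) :
      RookRel n (lWord i h) (eWord (i + 1) h * lWord i h)
  | l_e_succ (i : ℕ) (h : i + 1 < n) (h₀ : i < n) :
      RookRel n (lWord i h * eWord (i + 1) h) (eWord i h₀ * eWord (i + 1) h)
  | e_e_succ (i : ℕ) (h : i + 1 < n) (h₀ : i < n) :
      RookRel n (eWord i h₀ * eWord (i + 1) h) (eWord i h₀ * lWord i h)
  | e_l_self (i : ℕ) (h : i + 1 < n) (h₀ : i < n) :
      RookRel n (eWord i h₀ * lWord i h) (lWord i h ^ 3)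
  | l_cube (i : ℕ) (h : i + 1 < n) : RookRel n (lWord i h ^ 3) (lWord i h ^ 2)
  | e_l_comm (i j : ℕ) (hi : i < n) (hj : j + 1 < n) (h₁ : i ≠ j) (h₂ : i ≠ j + 1) :
      RookRel n (eWord i hi * lWord j hj) (lWord j hj * eWord i hi)
  | l_l_comm (i j : ℕ) (hi : i + 1 < n) (hj : j + 1 < n) (hij : 2 ≤ |(i : ℤ) - (j : ℤ)|) :
      RookRel n (lWord i hi * lWord j hj) (lWord j hj * lWord i hi)
  | e_e_comm (i j : ℕ) (hi : i < n) (hj : j < n) :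
      RookRel n (eWord i hi * eWord j hj) (eWord j hj * eWord i hi)

/-! The relations hold in `B_n`, so evaluation is a homomorphism; it is bijective because each `f`
in `B_n` is the value of exactly one class `w`. The induction is on the total distance `descent f`.
If `f` moves a point, the least one is some `i + 1`, and `f` is undefined at `i`. Then `f = f' l_i`,
where `f' = f * lInv i h` lies in `B_n` and has smaller descent, which gives existence. For
uniqueness, a class `w` over `f` satisfies `w = w e_i` (`mul_eGen_of_not_mapsTo`) and `w e_i = v
l_i` (`exists_mul_lGen`). Hence `w = (v e_{i+1}) l_i`, and `v e_{i+1}` lies over `f'`, so it is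
determined by induction. If `f` moves nothing, let `E` be the product of the `e_j` with `f`
undefined at `j`. A class `w` over `f` absorbs `E` (`mul_eProd_self`), while `E` absorbs `w`
(`mul_eProd_of_fixes`), so `w = w E = E`. -/

namespace RookMonoid

variable {n : ℕ}

/-! ### Pointwise calculus of rook maps -/

/-- The value of the partial map `f` at `a`, if it is defined. -/
def value (f : RookMonoid n) (a : Fin n) : Option (Fin n) :=
  (show Fin n ≃. Fin n from f) a

theorem mapsTo_iff_value {f : RookMonoid n} {a x : Fin n} : f.MapsTo a x ↔ f.value a = some x :=
  Iff.rfl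

theorem ext_value {f g : RookMonoid n} (h : ∀ a, f.value a = g.value a) : f = g :=
  PEquiv.ext h

theorem value_one (a : Fin n) : (1 : RookMonoid n).value a = some a := rfl

theorem value_mul (g f : RookMonoid n) (a : Fin n) :
    (g * f).value a = (f.value a).bind g.value := rfl

theorem value_lMap (i : ℕ) (h : i + 1 < n) (a : Fin n) : (lMap i h).value a =
    if a.val = i then none else if a.val = i + 1 then some ⟨i, Nat.lt_of_succ_lt h⟩
    else some a := rfl

theorem ext_mapsTo {f g : RookMonoid n} (h : ∀ a x, f.MapsTo a x ↔ g.MapsTo a x) : f = g :=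
  ext_value fun a => Option.ext fun x => h a x

theorem MapsTo.right_unique {f : RookMonoid n} {a x y : Fin n} (hx : f.MapsTo a x)
    (hy : f.MapsTo a y) : x = y :=
  Option.some_inj.1 (hx.symm.trans hy)

theorem mapsTo_eMap {j : ℕ} {h : j < n} {a x : Fin n} :
    (eMap j h).MapsTo a x ↔ a = x ∧ x.val ≠ j := by
  refine (PEquiv.mem_ofSet_iff (s := {a : Fin n | a.val ≠ j})).trans ?_
  constructor <;> (rintro ⟨rfl, h⟩; exact ⟨rfl, h⟩)

theorem value_eMap (j : ℕ) (h : j < n) (a : Fin n) :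
    (eMap j h).value a = if a.val = j then none else some a := by
  refine Option.ext fun x => ?_
  rw [← mapsTo_iff_value, mapsTo_eMap]
  split_ifs <;> grind

theorem mapsTo_lMap {i : ℕ} {h : i + 1 < n} {a x : Fin n} :
    (lMap i h).MapsTo a x ↔
      (a.val = i + 1 ∧ x.val = i) ∨ (a = x ∧ a.val ≠ i ∧ a.val ≠ i + 1) := by
  rw [mapsTo_iff_value, value_lMap]
  simp only [Fin.ext_iff]
  split_ifs <;> simp only [Option.some_inj, Fin.ext_iff, false_iff] <;> omega

theorem mul_eMap_of_not_mapsTo {f : RookMonoid n} {j : ℕ} {h : j < n}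
    (hf : ∀ x, ¬ f.MapsTo ⟨j, h⟩ x) : f * eMap j h = f := by
  refine ext_mapsTo fun a x => ?_
  rw [mapsTo_mul]
  constructor
  · rintro ⟨b, hb, hx⟩
    rwa [(mapsTo_eMap.1 hb).1]
  · intro hx
    refine ⟨a, mapsTo_eMap.2 ⟨rfl, ?_⟩, hx⟩
    rintro rfl
    exact hf x hx

/-! ### Splitting off `l_i` and the descent -/

/-- The inverse of the partial map `l_i`. -/
def lInv (i : ℕ) (h : i + 1 < n) : RookMonoid n := PEquiv.symm (lMap i h)

theorem mapsTo_lInv {i : ℕ} {h : i + 1 < n} {a x : Fin n} :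
    (lInv i h).MapsTo a x ↔
      (a.val = i ∧ x.val = i + 1) ∨ (a = x ∧ a.val ≠ i ∧ a.val ≠ i + 1) := by
  refine Iff.trans (PEquiv.eq_some_iff (lMap i h)) (mapsTo_lMap.trans ?_)
  grind

theorem lMap_mul_lInv {i : ℕ} (h : i + 1 < n) : lMap i h * lInv i h = eMap (i + 1) h := by
  refine ext_mapsTo fun a x => ?_
  simp only [mapsTo_mul, mapsTo_eMap, mapsTo_lMap, mapsTo_lInv, Fin.ext_iff]
  refine ⟨by rintro ⟨b, hb⟩; omega, fun hx => ?_⟩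
  by_cases ha : a.val = i
  · exact ⟨⟨i + 1, h⟩, by dsimp only; omega⟩
  · exact ⟨a, by omega⟩

theorem lInv_mul_lMap {i : ℕ} (h : i + 1 < n) :
    lInv i h * lMap i h = eMap i (Nat.lt_of_succ_lt h) := by
  refine ext_mapsTo fun a x => ?_
  simp only [mapsTo_mul, mapsTo_eMap, mapsTo_lMap, mapsTo_lInv, Fin.ext_iff]
  refine ⟨by rintro ⟨b, hb⟩; omega, fun hx => ?_⟩
  by_cases ha : a.val = i + 1
  · exact ⟨⟨i, by omega⟩, by dsimp only; omega⟩
  · exact ⟨a, by omega⟩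

/-- The total distance by which `f` moves the points of its domain down. -/
def descent (f : RookMonoid n) : ℕ :=
  ∑ a : Fin n, (f.value a).elim 0 fun x => a.val - x.val

theorem descent_mul_lInv_lt {f : RookMonoid n} {i : ℕ} {h : i + 1 < n} {x : Fin n}
    (hf : f.MapsTo ⟨i + 1, h⟩ x) (hx : x.val ≤ i) : (f * lInv i h).descent < f.descent := by
  let p : Fin n := ⟨i, Nat.lt_of_succ_lt h⟩
  let q : Fin n := ⟨i + 1, h⟩
  have hp : (lInv i h).value p = some q := mapsTo_lInv.2 (Or.inl ⟨rfl, rfl⟩)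
  have hq : (lInv i h).value q = none :=
    Option.eq_none_iff_forall_ne_some.2 fun y hy => by
      have := mapsTo_lInv.1 hy
      simp only [q] at this
      omega
  have hf' : f.value q = some x := hf
  unfold descent
  -- The term of `f` at `i + 1` is compared with the new term at `i`, which is one smaller; the new
  -- term at `i + 1` is `0`.
  rw [← Equiv.sum_comp (Equiv.swap p q) fun a : Fin n =>
    (f.value a).elim 0 fun x => a.val - x.val]
  refine Finset.sum_lt_sum (fun a _ => ?_) ⟨p, Finset.mem_univ _, ?_⟩
  · by_cases hap : a = p
    · subst hap
      rw [value_mul, hp, Option.bind_some, Equiv.swap_apply_left, hf']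
      simp only [Option.elim_some, p, q]
      omega
    by_cases haq : a = q
    · subst haq
      rw [value_mul, hq]
      exact Nat.zero_le _
    · rw [Equiv.swap_apply_of_ne_of_ne hap haq, value_mul,
        show (lInv i h).value a = some a from
          mapsTo_lInv.2 (Or.inr ⟨rfl, fun h => hap (Fin.ext h), fun h => haq (Fin.ext h)⟩)]
      exact le_rfl
  · rw [value_mul, hp, Option.bind_some, Equiv.swap_apply_left, hf']
    simp only [Option.elim_some, p, q]
    omega

/-- The inverse of `l_i` preserves order but raises `i` to `i + 1`; this is harmless because `f`
sends `i + 1` to `x ≤ i`. -/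
theorem mul_lInv_mem {f : RookMonoid n} (hf : f ∈ planarUpperRook n) {i : ℕ} {h : i + 1 < n}
    {x : Fin n} (hx : f.MapsTo ⟨i + 1, h⟩ x) (hxi : x.val ≤ i)
    (hi : ∀ y, ¬ f.MapsTo ⟨i, Nat.lt_of_succ_lt h⟩ y) : f * lInv i h ∈ planarUpperRook n := by
  refine ⟨fun a b y z hay hbz hab => ?_, fun a y hay => ?_⟩
  · obtain ⟨c, hc, hcy⟩ := mapsTo_mul.1 hay
    obtain ⟨d, hd, hdz⟩ := mapsTo_mul.1 hbz
    refine hf.1 c d y z hcy hdz ?_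
    have hdi : d.val ≠ i := fun e => hi z (by rwa [show d = ⟨i, _⟩ from Fin.ext e] at hdz)
    rw [mapsTo_lInv] at hc hd
    rw [Fin.lt_def] at hab ⊢
    simp only [Fin.ext_iff] at hc hd
    omega
  · obtain ⟨c, hc, hcy⟩ := mapsTo_mul.1 hay
    rcases mapsTo_lInv.1 hc with ⟨ha, hci⟩ | ⟨rfl, -, -⟩
    · rw [show c = ⟨i + 1, h⟩ from Fin.ext hci] at hcy
      rw [hcy.right_unique hx, Fin.le_def]
      omega
    · exact hf.2 a y hcy

/-- The least point moved by `f` is of the form `i + 1`, where `f` is undefined at `i`. -/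
theorem exists_first_moved {f : RookMonoid n} (hf : f ∈ planarUpperRook n)
    (hm : ∃ a x, f.MapsTo a x ∧ a ≠ x) :
    ∃ (i : ℕ) (h : i + 1 < n) (x : Fin n), f.MapsTo ⟨i + 1, h⟩ x ∧ x.val ≤ i ∧
      ∀ y, ¬ f.MapsTo ⟨i, Nat.lt_of_succ_lt h⟩ y := by
  obtain ⟨a, ⟨x, hax, hne⟩, hmin⟩ := WellFounded.has_min (wellFounded_lt (α := Fin n))
    {a | ∃ x, f.MapsTo a x ∧ a ≠ x} hm
  have hle := hf.2 a x hax
  rw [Fin.le_def] at hle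
  rw [ne_eq, Fin.ext_iff] at hne
  obtain ⟨k, hk⟩ := a
  obtain ⟨i, rfl⟩ : ∃ i, k = i + 1 := ⟨k - 1, by simp only at hne hle; omega⟩
  refine ⟨i, hk, x, hax, by simp only at hne hle; omega, fun y hy => ?_⟩
  have hyi : y = ⟨i, Nat.lt_of_succ_lt hk⟩ := by
    by_contra hne'
    exact hmin _ ⟨y, hy, fun e => hne' e.symm⟩ (Fin.mk_lt_mk.2 (Nat.lt_succ_self i))
  -- If `f` fixed `i`, order preservation would force `x > i`.
  have hlt := hf.1 _ _ _ _ hy hax (Fin.mk_lt_mk.2 (Nat.lt_succ_self i))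
  rw [hyi, Fin.lt_def] at hlt
  simp only at hlt hne hle
  omega

end RookMonoid

open RookMonoid

/-! ### Soundness of the relations -/

theorem toRook_rel {n : ℕ} (u v : FreeMonoid (RookGen n)) (h : RookRel n u v) :
    FreeMonoid.lift RookGen.toRook u = FreeMonoid.lift RookGen.toRook v := by
  apply Subtype.ext
  refine ext_value fun a => ?_
  cases h <;> simp only [lWord, eWord, map_mul, map_one, FreeMonoid.lift_eval_of, pow_succ,
    pow_zero, one_mul, RookGen.toRook, Submonoid.coe_mul, Submonoid.coe_one, value_mul, value_one,
    value_lMap, value_eMap]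
  all_goals
    try rw [le_abs] at *
    repeat' first
      | rfl
      | contradiction
      | (exfalso; omega)
      | split
      | simp only [Option.bind_some, Option.bind_none, value_mul, value_lMap]

/-! ### The presented monoid and its evaluation -/

namespace PlanarRook

variable {n : ℕ}

/-- The class of the symbol `l_i` in the presented monoid. -/
def lGen (i : ℕ) (h : i + 1 < n) : PresentedMonoid (RookRel n) :=
  PresentedMonoid.of (RookRel n) (.l i h)

/-- The class of the symbol `e_j` in the presented monoid. -/
def eGen (j : ℕ) (h : j < n) : PresentedMonoid (RookRel n) :=
  PresentedMonoid.of (RookRel n) (.e j h)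

theorem of_one : PresentedMonoid.of (RookRel n) .one = 1 :=
  PresentedMonoid.mk_eq_mk_of_rel RookRel.one_eq

theorem eGen_mul_self (i : ℕ) (h : i < n) : eGen i h * eGen i h = eGen i h :=
  (pow_two _).symm.trans (PresentedMonoid.mk_eq_mk_of_rel (.e_idem i h))

theorem lGen_mul_eGen_self (i : ℕ) (h : i + 1 < n) :
    lGen i h * eGen i (Nat.lt_of_succ_lt h) = lGen i h :=
  PresentedMonoid.mk_eq_mk_of_rel (.l_e_self i h _)

theorem eGen_succ_mul_lGen (i : ℕ) (h : i + 1 < n) : eGen (i + 1) h * lGen i h = lGen i h :=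
  (PresentedMonoid.mk_eq_mk_of_rel (.e_succ_l i h)).symm

theorem lGen_mul_eGen_succ (i : ℕ) (h : i + 1 < n) :
    lGen i h * eGen (i + 1) h = eGen i (Nat.lt_of_succ_lt h) * eGen (i + 1) h :=
  PresentedMonoid.mk_eq_mk_of_rel (.l_e_succ i h _)

theorem eGen_mul_lGen_self (i : ℕ) (h : i + 1 < n) :
    eGen i (Nat.lt_of_succ_lt h) * lGen i h = eGen i (Nat.lt_of_succ_lt h) * eGen (i + 1) h :=
  (PresentedMonoid.mk_eq_mk_of_rel (.e_e_succ i h _)).symm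

theorem eGen_mul_lGen_comm (i j : ℕ) (hi : i < n) (hj : j + 1 < n) (h₁ : i ≠ j)
    (h₂ : i ≠ j + 1) : eGen i hi * lGen j hj = lGen j hj * eGen i hi :=
  PresentedMonoid.mk_eq_mk_of_rel (.e_l_comm i j hi hj h₁ h₂)

theorem lGen_mul_lGen_comm (i j : ℕ) (hi : i + 1 < n) (hj : j + 1 < n)
    (hij : 2 ≤ |(i : ℤ) - (j : ℤ)|) : lGen i hi * lGen j hj = lGen j hj * lGen i hi :=
  PresentedMonoid.mk_eq_mk_of_rel (.l_l_comm i j hi hj hij)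

theorem eGen_mul_eGen_comm (i j : ℕ) (hi : i < n) (hj : j < n) :
    eGen i hi * eGen j hj = eGen j hj * eGen i hi :=
  PresentedMonoid.mk_eq_mk_of_rel (.e_e_comm i j hi hj)

/-- The evaluation of the presented monoid in the planar upper triangular rook monoid. -/
def toPlanar (n : ℕ) : PresentedMonoid (RookRel n) →* planarUpperRook n :=
  PresentedMonoid.lift RookGen.toRook toRook_rel

/-- The evaluation of the presented monoid in the rook monoid. -/
def eval : PresentedMonoid (RookRel n) →* RookMonoid n :=
  (planarUpperRook n).subtype.comp (toPlanar n)

theorem eval_mem (w : PresentedMonoid (RookRel n)) : eval w ∈ planarUpperRook n :=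
  (toPlanar n w).2

theorem eval_lGen (i : ℕ) (h : i + 1 < n) : eval (lGen i h) = lMap i h := rfl

theorem eval_eGen (j : ℕ) (h : j < n) : eval (eGen j h) = eMap j h := rfl

@[elab_as_elim]
theorem induction_right {motive : PresentedMonoid (RookRel n) → Prop}
    (w : PresentedMonoid (RookRel n)) (one : motive 1)
    (l : ∀ w i h, motive w → motive (w * lGen i h))
    (e : ∀ w j h, motive w → motive (w * eGen j h)) : motive w := by
  have hw : w ∈ Submonoid.closure (Set.range (PresentedMonoid.of (RookRel n))) := by
    rw [PresentedMonoid.closure_range_of]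
    trivial
  induction hw using Submonoid.closure_induction_right with
  | one => exact one
  | mul_right x _ y hy ih =>
    obtain ⟨_ | ⟨i, h⟩ | ⟨j, h⟩, rfl⟩ := hy
    · rwa [of_one, mul_one]
    · exact l x i h ih
    · exact e x j h ih

/-- If `w` is undefined at `a`, then `e_a` is absorbed by `w` on the right. -/
theorem mul_eGen_of_not_mapsTo (w : PresentedMonoid (RookRel n)) :
    ∀ (a : ℕ) (ha : a < n), (∀ x, ¬ (eval w).MapsTo ⟨a, ha⟩ x) → w * eGen a ha = w := by
  induction w using induction_right with
  | one =>
    intro a ha h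
    exact absurd (mapsTo_one.2 rfl) (h ⟨a, ha⟩)
  | l w i hi ih =>
    intro a ha h
    simp only [map_mul, eval_lGen, mapsTo_mul, mapsTo_lMap, not_exists, not_and] at h
    rcases eq_or_ne a i with rfl | hai
    · rw [mul_assoc, lGen_mul_eGen_self]
    rcases eq_or_ne a (i + 1) with rfl | hai'
    -- Here `l_i e_{i+1} = e_i l_i`, and `w` is undefined at `i`, the image of `i + 1` under `l_i`.
    · rw [mul_assoc, lGen_mul_eGen_succ, ← eGen_mul_lGen_self, ← mul_assoc,
        ih i _ fun x => h x ⟨i, Nat.lt_of_succ_lt hi⟩ (Or.inl ⟨rfl, rfl⟩)]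
    · rw [mul_assoc, ← eGen_mul_lGen_comm a i ha hi hai hai', ← mul_assoc,
        ih a ha fun x => h x ⟨a, ha⟩ (Or.inr ⟨rfl, hai, hai'⟩)]
  | e w j hj ih =>
    intro a ha h
    simp only [map_mul, eval_eGen, mapsTo_mul, mapsTo_eMap, not_exists, not_and] at h
    rcases eq_or_ne a j with rfl | haj
    · rw [mul_assoc, eGen_mul_self]
    · rw [mul_assoc, eGen_mul_eGen_comm, ← mul_assoc, ih a ha fun x => h x ⟨a, ha⟩ ⟨rfl, haj⟩]

/-- If `w` moves the point `i + 1`, then after restriction to the complement of `i` the symbol `l_i`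
can be split off from `w` on the right. -/
theorem exists_mul_lGen (w : PresentedMonoid (RookRel n)) :
    ∀ (i : ℕ) (h : i + 1 < n) (x : Fin n), (eval w).MapsTo ⟨i + 1, h⟩ x → x.val ≤ i →
      ∃ u, w * eGen i (Nat.lt_of_succ_lt h) = u * lGen i h := by
  induction w using induction_right with
  | one =>
    intro i h x hx hxi
    rw [map_one, mapsTo_one] at hx
    subst hx
    exact absurd hxi (Nat.not_succ_le_self i)
  | l w j hj ih =>
    intro i h x hx hxi
    rw [map_mul, eval_lGen, mapsTo_mul] at hx
    obtain ⟨b, hb, hx⟩ := hx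
    rw [mapsTo_lMap] at hb
    dsimp only at hb
    rcases eq_or_ne i j with rfl | hij
    · exact ⟨w, by rw [mul_assoc, lGen_mul_eGen_self]⟩
    have hb' : b = ⟨i + 1, h⟩ := by
      rcases hb with hb | hb
      · omega
      · exact hb.1.symm
    subst hb'
    obtain ⟨u, hu⟩ := ih i h x hx hxi
    rcases eq_or_ne i (j + 1) with rfl | hij'
    · refine ⟨u * eGen j (Nat.lt_of_succ_lt hj), ?_⟩
      rw [mul_assoc, lGen_mul_eGen_succ, eGen_mul_eGen_comm, ← mul_assoc, hu, mul_assoc,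
        mul_assoc, eGen_mul_lGen_comm j (j + 1) _ h (by omega) (by omega)]
    -- `hb` excludes `j = i + 1`, where `l_j` is undefined at `i + 1`; hence `|i - j| ≥ 2`.
    · refine ⟨u * lGen j hj, ?_⟩
      rw [mul_assoc, ← eGen_mul_lGen_comm i j _ hj hij hij', ← mul_assoc, hu, mul_assoc,
        mul_assoc, lGen_mul_lGen_comm i j h hj (by rw [le_abs]; omega)]
  | e w j hj ih =>
    intro i h x hx hxi
    rw [map_mul, eval_eGen, mapsTo_mul] at hx
    obtain ⟨b, hb, hx⟩ := hx
    rw [mapsTo_eMap] at hb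
    obtain ⟨rfl, hj'⟩ := hb
    obtain ⟨u, hu⟩ := ih i h x hx hxi
    rw [mul_assoc, eGen_mul_eGen_comm, ← mul_assoc, hu, mul_assoc]
    rcases eq_or_ne j i with rfl | hji
    · exact ⟨u, by rw [lGen_mul_eGen_self]⟩
    · exact ⟨u * eGen j hj, by
        rw [← eGen_mul_lGen_comm j i hj h hji (Ne.symm hj'), mul_assoc]⟩

/-! ### Partial identities -/

open Classical in
/-- The product of the `e_j`, with `j` in the list `L`, such that `f` is undefined at `j`. -/
noncomputable def eProd (f : RookMonoid n) (L : List (Fin n)) : PresentedMonoid (RookRel n) :=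
  (L.map fun j => if ∃ x, f.MapsTo j x then 1 else eGen j.val j.isLt).prod

theorem eProd_cons (f : RookMonoid n) (j : Fin n) (L : List (Fin n)) :
    ((∃ x, f.MapsTo j x) ∧ eProd f (j :: L) = eProd f L) ∨
      ((∀ x, ¬ f.MapsTo j x) ∧ eProd f (j :: L) = eGen j.val j.isLt * eProd f L) := by
  unfold eProd
  rw [List.map_cons, List.prod_cons]
  by_cases hj : ∃ x, f.MapsTo j x
  · exact Or.inl ⟨hj, by rw [if_pos hj, one_mul]⟩
  · exact Or.inr ⟨not_exists.1 hj, by rw [if_neg hj]⟩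

theorem eGen_mul_eProd {f : RookMonoid n} {L : List (Fin n)} {a : Fin n} (haL : a ∈ L)
    (ha : ∀ x, ¬ f.MapsTo a x) : eGen a.val a.isLt * eProd f L = eProd f L := by
  induction L with
  | nil => exact absurd haL List.not_mem_nil
  | cons j L ih =>
    rcases List.mem_cons.1 haL with rfl | haL
    · rcases eProd_cons f a L with ⟨⟨x, hx⟩, -⟩ | ⟨-, h⟩
      · exact absurd hx (ha x)
      · rw [h, ← mul_assoc, eGen_mul_self]
    · rcases eProd_cons f j L with ⟨-, h⟩ | ⟨-, h⟩
      · rw [h, ih haL]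
      · rw [h, ← mul_assoc, eGen_mul_eGen_comm, mul_assoc, ih haL]

theorem mul_eProd_self {w : PresentedMonoid (RookRel n)} (L : List (Fin n)) :
    w * eProd (eval w) L = w := by
  induction L with
  | nil => exact mul_one w
  | cons j L ih =>
    rcases eProd_cons (eval w) j L with ⟨-, h⟩ | ⟨hj, h⟩
    · rw [h, ih]
    · rw [h, ← mul_assoc, mul_eGen_of_not_mapsTo w j.val j.isLt hj, ih]

theorem mapsTo_eval_eProd {f : RookMonoid n} {L : List (Fin n)} {a x : Fin n} :
    (eval (eProd f L)).MapsTo a x ↔ a = x ∧ (a ∈ L → ∃ y, f.MapsTo a y) := by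
  induction L with
  | nil =>
    rw [show eProd f [] = 1 from rfl, map_one, mapsTo_one]
    simp
  | cons j L ih =>
    rcases eProd_cons f j L with ⟨hj, h⟩ | ⟨hj, h⟩
    · rw [h, ih]
      grind
    · rw [h, map_mul, mapsTo_mul, eval_eGen]
      constructor
      · rintro ⟨b, hb, hbx⟩
        obtain ⟨rfl, hxj⟩ := mapsTo_eMap.1 hbx
        refine ⟨(ih.1 hb).1, fun haL => (ih.1 hb).2 ?_⟩
        rcases List.mem_cons.1 haL with rfl | haL
        · exact absurd (congrArg Fin.val (ih.1 hb).1).symm hxj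
        · exact haL
      · rintro ⟨rfl, haL⟩
        refine ⟨a, ih.2 ⟨rfl, fun h => haL (List.mem_cons_of_mem j h)⟩, mapsTo_eMap.2 ⟨rfl, ?_⟩⟩
        intro e
        obtain rfl := Fin.ext e
        obtain ⟨y, hy⟩ := haL List.mem_cons_self
        exact hj y hy

/-- A word that fixes every point of the domain of `f` is trivial on that domain. -/
theorem mul_eProd_of_fixes {f : RookMonoid n} (w : PresentedMonoid (RookRel n)) :
    (∀ a x, f.MapsTo a x → (eval w).MapsTo a a) →
      w * eProd f (List.finRange n) = eProd f (List.finRange n) := by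
  induction w using induction_right with
  | one => exact fun _ => one_mul _
  | l w i hi ih =>
    intro hw
    have hw' : ∀ a x, f.MapsTo a x → a.val ≠ i ∧ a.val ≠ i + 1 ∧ (eval w).MapsTo a a := by
      intro a x hx
      have := hw a x hx
      rw [map_mul, mapsTo_mul] at this
      obtain ⟨b, hb, hba⟩ := this
      rcases mapsTo_lMap.1 hb with ⟨ha, hbi⟩ | ⟨rfl, h₁, h₂⟩
      -- `l_i` has lowered `a`, and the order decreasing `w` cannot raise it back.
      · have := (eval_mem w).2 b a hba
        rw [Fin.le_def] at this
        omega
      · exact ⟨h₁, h₂, hba⟩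
    have h₁ := eGen_mul_eProd (f := f) (List.mem_finRange ⟨i, Nat.lt_of_succ_lt hi⟩)
      fun x hx => (hw' _ x hx).1 rfl
    have h₂ := eGen_mul_eProd (f := f) (List.mem_finRange ⟨i + 1, hi⟩)
      fun x hx => (hw' _ x hx).2.1 rfl
    dsimp only at h₁ h₂
    -- Once `e_{i+1}` is drawn out of the product, `l_i` acts as `e_i`, which is absorbed too.
    have h₃ : lGen i hi * eProd f (List.finRange n) = eProd f (List.finRange n) := by
      rw [← h₂, ← mul_assoc, lGen_mul_eGen_succ, mul_assoc, h₂, h₁]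
    rw [mul_assoc, h₃]
    exact ih fun a x hx => (hw' a x hx).2.2
  | e w j hj ih =>
    intro hw
    have hw' : ∀ a x, f.MapsTo a x → a.val ≠ j ∧ (eval w).MapsTo a a := by
      intro a x hx
      have := hw a x hx
      rw [map_mul, eval_eGen, mapsTo_mul] at this
      obtain ⟨b, hb, hba⟩ := this
      obtain ⟨rfl, h⟩ := mapsTo_eMap.1 hb
      exact ⟨h, hba⟩
    have h₁ := eGen_mul_eProd (f := f) (List.mem_finRange ⟨j, hj⟩) fun x hx => (hw' _ x hx).1 rfl
    rw [mul_assoc, h₁]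
    exact ih fun a x hx => (hw' a x hx).2

/-! ### Unique representation and the isomorphism -/

/-- Every element of the planar upper triangular rook monoid is the value of exactly one element of
the presented monoid. -/
theorem existsUnique_eval_eq (f : RookMonoid n) (hf : f ∈ planarUpperRook n) :
    ∃! w, eval w = f := by
  induction hd : f.descent using Nat.strong_induction_on generalizing f with
  | _ d ih =>
    subst hd
    by_cases hm : ∃ a x, f.MapsTo a x ∧ a ≠ x
    · obtain ⟨i, h, x, hx, hxi, hi⟩ := exists_first_moved hf hm
      obtain ⟨u, hu, huniq⟩ :=
        ih _ (descent_mul_lInv_lt hx hxi) _ (mul_lInv_mem hf hx hxi hi) rfl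
      refine ⟨u * lGen i h, ?_, fun w hw => ?_⟩
      · dsimp only
        rw [map_mul, hu, eval_lGen, mul_assoc, lInv_mul_lMap, mul_eMap_of_not_mapsTo hi]
      · dsimp only at hw
        subst hw
        obtain ⟨v, hv⟩ := exists_mul_lGen w i h x hx hxi
        rw [mul_eGen_of_not_mapsTo w _ _ hi] at hv
        -- The factor `e_{i+1} = l_i l_i⁻¹` cuts `v` down to the range of `l_i`, so that its value
        -- becomes `f l_i⁻¹`.
        rw [← huniq (v * eGen (i + 1) h), mul_assoc, eGen_succ_mul_lGen, hv]
        dsimp only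
        rw [hv, map_mul, map_mul, mul_assoc, eval_lGen, lMap_mul_lInv, eval_eGen]
    · have hfix : ∀ a x, f.MapsTo a x → a = x := fun a x hx =>
        by_contra fun hne => hm ⟨a, x, hx, hne⟩
      refine ⟨eProd f (List.finRange n), ?_, fun w hw => ?_⟩
      · refine ext_mapsTo fun a x => ?_
        rw [mapsTo_eval_eProd]
        constructor
        · rintro ⟨rfl, h⟩
          obtain ⟨y, hy⟩ := h (List.mem_finRange a)
          rwa [← hfix a y hy] at hy
        · exact fun hx => ⟨hfix a x hx, fun _ => ⟨x, hx⟩⟩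
      · dsimp only at hw
        subst hw
        rw [← mul_eProd_of_fixes w, mul_eProd_self]
        intro a x hx
        rwa [← hfix a x hx] at hx

theorem toPlanar_bijective (n : ℕ) : Function.Bijective (toPlanar n) := by
  refine ⟨fun u v huv => ?_, fun f => ?_⟩
  · exact (existsUnique_eval_eq (eval v) (eval_mem v)).unique (congrArg Subtype.val huv) rfl
  · obtain ⟨w, hw, -⟩ := existsUnique_eval_eq f.1 f.2
    exact ⟨w, Subtype.ext hw⟩

end PlanarRook

/-- The monoid `B_n` has the presentation `⟨G | R⟩`: sending every generating symbol to the element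
of `B_n` it stands for gives a well-defined isomorphism from the presented monoid onto `B_n`. -/
theorem theorem5p4 (n : ℕ) :
    ∃ φ : PresentedMonoid (RookRel n) ≃* planarUpperRook n,
      ∀ g : RookGen n, φ (PresentedMonoid.of (RookRel n) g) = g.toRook :=
  ⟨MulEquiv.ofBijective (PlanarRook.toPlanar n) (PlanarRook.toPlanar_bijective n), fun _ => rfl⟩
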